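/- Let $\mathcal C,\mathcal D$ be 2-categories, $U:\mathcal D\to\mathcal C$ a pseudofunctor with invertible 2-cells $\gamma: U(g\circ f)\Rightarrow Ug\circ Uf$ and $\iota:U1\Rightarrow 1$, and suppose that for every object $A\in\mathcal C$ we are given an object $FA\in\mathcal D$ and a 1-cell $y_A:A\to UFA$. For $f:A\to UB$, a left $U$-extension of $f$ along $y_A$ is a pair $(f':FA\to B,\ \psi:f\Rightarrow Uf'\circ y_A)$ such that for every $g:FA\to B$ and $\alpha:f\Rightarrow Ug\circ y_A$ there is a unique 2-cell $\theta:f'\Rightarrow g$ with $(U\theta\, y_A)\cdot\psi=\alpha$. Then the following are equivalent. (1) There is a choice, for all $A\in\mathcal C$, $B\in\mathcal D$ and $f:A\to UB$, of a left $U$-extension $(f^{\mathbb D},\mathbb D_f)$ of $f$ along $y_A$ such that: * (coherence) for every $f:X\to UY$, the 1-cell $1_{UY}^{\mathbb D}\circ(y_{UY}f)^{\mathbb D}$ with the pasting $$f\xrightarrow{\ \mathbb D_{1_{UY}}f\ }U(1_{UY}^{\mathbb D})\,y_{UY}\,f\xrightarrow{\ U(1_{UY}^{\mathbb D})\,\mathbb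 D_{y_{UY}f}\ }U(1_{UY}^{\mathbb D})\,U((y_{UY}f)^{\mathbb D})\,y_X\xrightarrow{\ \gamma^{-1}y_X\ }U\big(1_{UY}^{\mathbb D}\circ(y_{UY}f)^{\mathbb D}\big)\,y_X$$ is a left $U$-extension of $f$ along $y_X$; * (unit axiom) for every $A$, the pair $(1_{FA},\ \iota^{-1}y_A)$ is a left $U$-extension of $y_A$ along $y_A$; * (composition axiom) for all $f:A\to B$, $g:B\to C$ in $\mathcal C$, the 1-cell $(y_Cg)^{\mathbb D}\circ(y_Bf)^{\mathbb D}$ with the analogous pasting of $\mathbb D_{y_Cg}$, $\mathbb D_{y_Bf}$ and $\gamma^{-1}$ is a left $U$-extension of $y_C\,g\,f$ along $y_A$. (2) The object map $A\mapsto FA$ extends to a pseudofunctor $F:\mathcal C\to\mathcal D$ for which there is a colax adjunction $(\Psi,\Phi):(\epsilon,\eta):F\dashv\!\!\!\!\!\dashv U$ with $\Psi$ invertible and $\eta_A=y_A$ for every $A\in\mathcal C$. Here a colax adjunction consists of colax natural transformations $\eta:1\Rightarrow UF$, $\epsilon:FU\Rightarrow1$ (with 2-cells $\eta_f:\eta_B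 f\Rightarrow UFf\,\eta_A$ for $f:A\to B$ in $\mathcal C$, and $\epsilon_h:\epsilon_{B'}\,FUh\Rightarrow h\,\epsilon_B$ for $h:B\to B'$ in $\mathcal D$) and modifications $\Psi:\epsilon F\circ F\eta\to1_F$, $\Phi:1_U\to U\epsilon\circ\eta U$ satisfying the two swallowtail identities: for every $A\in\mathcal C$ and $B\in\mathcal D$ the composites $$\eta_A\xrightarrow{\Phi_{FA}\,\eta_A}U\epsilon_{FA}\,\eta_{UFA}\,\eta_A\xrightarrow{U\epsilon_{FA}\,\eta_{\eta_A}}U\epsilon_{FA}\,UF\eta_A\,\eta_A\xrightarrow{U\Psi_A\,\eta_A}\eta_A,$$ $$\epsilon_B\xrightarrow{\epsilon_B\,F\Phi_B}\epsilon_B\,FU\epsilon_B\,F\eta_{UB}\xrightarrow{\epsilon_{\epsilon_B}\,F\eta_{UB}}\epsilon_B\,\epsilon_{FUB}\,F\eta_{UB}\xrightarrow{\epsilon_B\,\Psi_{UB}}\epsilon_B$$ are identities, where $U\Psi_A$ and $F\Phi_B$ are normalized by the associators and unitors of $U$ and $F$. -/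

import Mathlib

open CategoryTheory Bicategory

universe w₁ w₂ v₁ v₂ u₁ u₂

namespace ColaxAdj

section Extensions

variable {C : Type u₁} [Bicategory.{w₁, v₁} C] {D : Type u₂} [Bicategory.{w₂, v₂} D]

/-- The pair `(f', ψ)` is a left `U`-extension of `f : A ⟶ U B` along `y : A ⟶ U X`: every 2-cell
`α : f ⟶ y ≫ U g` factors through `ψ` as the whiskering of `U θ` for exactly one `θ : f' ⟶ g`. -/
def IsLeftUExtension (U : D ⥤ᵖ C) {A : C} {X B : D} (y : A ⟶ U.obj X) (f : A ⟶ U.obj B)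
    (f' : X ⟶ B) (ψ : f ⟶ y ≫ U.map f') : Prop :=
  ∀ (g : X ⟶ B) (α : f ⟶ y ≫ U.map g), ∃! θ : f' ⟶ g, ψ ≫ y ◁ U.map₂ θ = α

/-- The pasting of a square `α : f ≫ z ⟶ y ≫ U k` with a triangle `β : v ⟶ z ≫ U m`, followed by
the inverse of the associator of `U`:
`f ≫ v ⟶ f ≫ z ≫ U m ⟶ y ≫ U k ≫ U m ⟶ y ≫ U (k ≫ m)`. -/
def pasteExt (U : D ⥤ᵖ C) {A P : C} {X X' B : D} {y : A ⟶ U.obj X} {z : P ⟶ U.obj X'}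
    {f : A ⟶ P} {v : P ⟶ U.obj B} {k : X ⟶ X'} {m : X' ⟶ B}
    (α : f ≫ z ⟶ y ≫ U.map k) (β : v ⟶ z ≫ U.map m) : f ≫ v ⟶ y ≫ U.map (k ≫ m) :=
  f ◁ β ≫ (α_ f z (U.map m)).inv ≫ α ▷ U.map m ≫ (α_ y (U.map k) (U.map m)).hom ≫
    y ◁ (U.mapComp k m).inv

/-- A choice, for every `f : A ⟶ U B`, of a left `U`-extension of `f` along `y A`. -/
structure UExtensionChoice (U : D ⥤ᵖ C) {F₀ : C → D} (y : ∀ A : C, A ⟶ U.obj (F₀ A)) where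
  /-- the extending 1-cell -/
  ext {A : C} {B : D} (f : A ⟶ U.obj B) : F₀ A ⟶ B
  /-- the 2-cell accompanying the extension -/
  cell {A : C} {B : D} (f : A ⟶ U.obj B) : f ⟶ y A ≫ U.map (ext f)
  isLeftUExtension {A : C} {B : D} (f : A ⟶ U.obj B) :
    IsLeftUExtension U (y A) f (ext f) (cell f)

namespace UExtensionChoice

variable {U : D ⥤ᵖ C} {F₀ : C → D} {y : ∀ A : C, A ⟶ U.obj (F₀ A)}

/-- Coherence of a choice of `U`-extensions: for every `f : X ⟶ U Y`, the pasting of the chosen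
extensions of `f ≫ y (U Y)` and of the identity of `U Y` is a left `U`-extension of `f` along
`y X`. -/
def IsCoherent (E : UExtensionChoice U y) : Prop :=
  ∀ {X : C} {Y : D} (f : X ⟶ U.obj Y),
    IsLeftUExtension U (y X) f (E.ext (f ≫ y (U.obj Y)) ≫ E.ext (𝟙 (U.obj Y)))
      ((ρ_ f).inv ≫ pasteExt U (E.cell (f ≫ y (U.obj Y))) (E.cell (𝟙 (U.obj Y))))

/-- The composition axiom: for `f : A ⟶ B` and `g : B ⟶ C'`, the pasting of the chosen extensions
of `f ≫ y B` and `g ≫ y C'` is a left `U`-extension of `f ≫ g ≫ y C'` along `y A`. -/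
def CompositionAxiom (E : UExtensionChoice U y) : Prop :=
  ∀ {A B C' : C} (f : A ⟶ B) (g : B ⟶ C'),
    IsLeftUExtension U (y A) (f ≫ g ≫ y C') (E.ext (f ≫ y B) ≫ E.ext (g ≫ y C'))
      (pasteExt U (E.cell (f ≫ y B)) (E.cell (g ≫ y C')))

end UExtensionChoice

/-- The unit axiom: `𝟙 (F₀ A)`, with the 2-cell given by the inverse of the unitor of `U`, is a
left `U`-extension of `y A` along `y A`. -/
def UnitAxiom (U : D ⥤ᵖ C) {F₀ : C → D} (y : ∀ A : C, A ⟶ U.obj (F₀ A)) : Prop :=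
  ∀ A : C, IsLeftUExtension U (y A) (y A) (𝟙 (F₀ A))
    ((ρ_ (y A)).inv ≫ y A ◁ (U.mapId (F₀ A)).inv)

end Extensions

section Cells

variable {C : Type u₁} [Bicategory.{w₁, v₁} C] {D : Type u₂} [Bicategory.{w₂, v₂} D]

/-- The image of a colax square under a pseudofunctor. -/
def mapSquare (H : C ⥤ᵖ D) {a b a' b' : C} {p : a ⟶ b} {x' : b ⟶ b'} {x : a ⟶ a'} {q : a' ⟶ b'}
    (σ : p ≫ x' ⟶ x ≫ q) : H.map p ≫ H.map x' ⟶ H.map x ≫ H.map q :=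
  (H.mapComp p x').inv ≫ H.map₂ σ ≫ (H.mapComp x q).hom

/-- The pasting of two adjacent colax squares: the component at a 1-cell of the composite of two
colax natural transformations. -/
def pasteSquares {a b a' b' a'' b'' : C} {p : a ⟶ b} {q : a' ⟶ b'} {r : a'' ⟶ b''}
    {x : a ⟶ a'} {x' : b ⟶ b'} {z : a' ⟶ a''} {z' : b' ⟶ b''}
    (σ : p ≫ x' ⟶ x ≫ q) (τ : q ≫ z' ⟶ z ≫ r) : p ≫ x' ≫ z' ⟶ (x ≫ z) ≫ r :=
  (α_ p x' z').inv ≫ σ ▷ z' ≫ (α_ x q z').hom ≫ x ◁ τ ≫ (α_ x z r).inv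

end Cells

variable {C : Type u₁} [Bicategory.{w₁, v₁} C] {D : Type u₂} [Bicategory.{w₂, v₂} D]

/-- The data underlying a colax adjunction between pseudofunctors `F : C ⥤ᵖ D` and `U : D ⥤ᵖ C`:
colax natural transformations `η : 1 ⟶ UF` and `ε : FU ⟶ 1` and the component 2-cells
`Ψ : εF ∘ Fη ⟶ 1` and `Φ : 1 ⟶ Uε ∘ ηU`. -/
structure ColaxAdjunctionData (F : C ⥤ᵖ D) (U : D ⥤ᵖ C) where
  /-- the unit, with 2-cells `f ≫ η B ⟶ η A ≫ U (F f)` -/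
  unit : Oplax.OplaxTrans (Pseudofunctor.id C).toOplax (F.comp U).toOplax
  /-- the counit, with 2-cells `F (U h) ≫ ε B' ⟶ ε B ≫ h` -/
  counit : Oplax.OplaxTrans (U.comp F).toOplax (Pseudofunctor.id D).toOplax
  Psi (A : C) : F.map (unit.app A) ≫ counit.app (F.obj A) ⟶ 𝟙 (F.obj A)
  Phi (B : D) : 𝟙 (U.obj B) ⟶ unit.app (U.obj B) ≫ U.map (counit.app B)

namespace ColaxAdjunctionData

variable {F : C ⥤ᵖ D} {U : D ⥤ᵖ C} (S : ColaxAdjunctionData F U)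

/-- The 1-cell component of the unit. -/
def unitAt (A : C) : A ⟶ U.obj (F.obj A) := S.unit.app A

/-- The 1-cell component of the counit. -/
def counitAt (B : D) : F.obj (U.obj B) ⟶ B := S.counit.app B

/-- The 2-cell component of the unit. -/
def unitCell {A A' : C} (f : A ⟶ A') : f ≫ S.unitAt A' ⟶ S.unitAt A ≫ U.map (F.map f) := S.unit.naturality f

/-- The 2-cell component of the counit. -/
def counitCell {B B' : D} (h : B ⟶ B') : F.map (U.map h) ≫ S.counitAt B' ⟶ S.counitAt B ≫ h :=
  S.counit.naturality h

/-- The component of `Ψ`. -/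
def Ψ (A : C) : F.map (S.unitAt A) ≫ S.counitAt (F.obj A) ⟶ 𝟙 (F.obj A) := S.Psi A

/-- The component of `Φ`. -/
def Φ (B : D) : 𝟙 (U.obj B) ⟶ S.unitAt (U.obj B) ≫ U.map (S.counitAt B) := S.Phi B

/-- The 2-cells `Ψ A` form a modification `εF ∘ Fη ⟶ 1_F`. -/
def PsiIsModification : Prop :=
  ∀ {A A' : C} (f : A ⟶ A'),
    F.map f ◁ S.Ψ A' ≫ (ρ_ (F.map f)).hom ≫ (λ_ (F.map f)).inv =
      pasteSquares (mapSquare F (S.unitCell f)) (S.counitCell (F.map f)) ≫ S.Ψ A ▷ F.map f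

/-- The 2-cells `Φ B` form a modification `1_U ⟶ Uε ∘ ηU`. -/
def PhiIsModification : Prop :=
  ∀ {B B' : D} (h : B ⟶ B'),
    U.map h ◁ S.Φ B' ≫ pasteSquares (S.unitCell (U.map h)) (mapSquare U (S.counitCell h)) =
      ((ρ_ (U.map h)).hom ≫ (λ_ (U.map h)).inv) ≫ S.Φ B ▷ U.map h

/-- The component of `UΨ`, normalized by the associator and the unitor of `U`. -/
def UΨ (A : C) : U.map (F.map (S.unitAt A)) ≫ U.map (S.counitAt (F.obj A)) ⟶ 𝟙 (U.obj (F.obj A)) :=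
  (U.mapComp _ _).inv ≫ U.map₂ (S.Ψ A) ≫ (U.mapId _).hom

/-- The component of `FΦ`, normalized by the associator and the unitor of `F`. -/
def FΦ (B : D) : 𝟙 (F.obj (U.obj B)) ⟶ F.map (S.unitAt (U.obj B)) ≫ F.map (U.map (S.counitAt B)) :=
  (F.mapId _).inv ≫ F.map₂ (S.Φ B) ≫ (F.mapComp _ _).hom

/-- The swallowtail identity on `η`: the pasting of `ΦF`, `ηη` and `UΨ` is the identity. -/
def SwallowtailUnit : Prop :=
  ∀ A : C,
    (ρ_ (S.unitAt A)).inv ≫ S.unitAt A ◁ S.Φ (F.obj A) ≫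
      (α_ (S.unitAt A) (S.unitAt (U.obj (F.obj A))) (U.map (S.counitAt (F.obj A)))).inv ≫
      S.unitCell (S.unitAt A) ▷ U.map (S.counitAt (F.obj A)) ≫
      (α_ (S.unitAt A) (U.map (F.map (S.unitAt A))) (U.map (S.counitAt (F.obj A)))).hom ≫
      S.unitAt A ◁ S.UΨ A ≫ (ρ_ (S.unitAt A)).hom = 𝟙 (S.unitAt A)

/-- The swallowtail identity on `ε`: the pasting of `FΦ`, `εε` and `ΨU` is the identity. -/
def SwallowtailCounit : Prop :=
  ∀ B : D,
    (λ_ (S.counitAt B)).inv ≫ S.FΦ B ▷ S.counitAt B ≫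
      (α_ (F.map (S.unitAt (U.obj B))) (F.map (U.map (S.counitAt B))) (S.counitAt B)).hom ≫
      F.map (S.unitAt (U.obj B)) ◁ S.counitCell (S.counitAt B) ≫
      (α_ (F.map (S.unitAt (U.obj B))) (S.counitAt (F.obj (U.obj B))) (S.counitAt B)).inv ≫
      S.Ψ (U.obj B) ▷ S.counitAt B ≫ (λ_ (S.counitAt B)).hom = 𝟙 (S.counitAt B)

end ColaxAdjunctionData

/-- A colax adjunction `(Ψ, Φ) : (ε, η) : F ⊣⊣ U` between pseudofunctors. -/
structure ColaxAdjunction (F : C ⥤ᵖ D) (U : D ⥤ᵖ C) extends ColaxAdjunctionData F U where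
  psi_modification : toColaxAdjunctionData.PsiIsModification
  phi_modification : toColaxAdjunctionData.PhiIsModification
  swallowtail_unit : toColaxAdjunctionData.SwallowtailUnit
  swallowtail_counit : toColaxAdjunctionData.SwallowtailCounit

end ColaxAdj

/-! Both conditions say that pasting with the 2-cell `cell f : f ⟶ η ≫ U (F f ≫ ε)`, built from
`η_f` and `Φ`, is a bijection from 2-cells `F f ≫ ε ⟶ g` to 2-cells `f ⟶ η ≫ U g`.

Given a colax adjunction, the inverse is `transpose`. The modification law of `Φ` and the
swallowtail on `η` make it a right inverse (`cell_comp_transpose`). The modification law of `Ψ` and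
the swallowtail on `ε` give `transpose (cell f) = 𝟙` (`transpose_cell`), hence uniqueness.
Invertibility of `Ψ` makes `transpose η_f` invertible; since extensions may be transported along
isomorphisms, the three axioms follow.

Given a choice of extensions, `F f` is the extension of `f ≫ y`, and all 2-cells of `F` come from
universality; the unit and composition axioms make its constraints invertible. Coherence says that
`F f ≫ ε` also extends `f`, so `ε_h` and `Ψ_A` can be defined as the solutions of the `Φ` law and of
the swallowtail on `η`. The other two laws equate 2-cells out of `F f ≫ ε`; pasting with `cell f`
reduces them to `cell_comp_transpose`. -/

namespace ColaxAdj

/-! ### Calculus of pastings with triangles `f ⟶ y ≫ U k` -/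

section Calculus

variable {C : Type u₁} [Bicategory.{w₁, v₁} C] {D : Type u₂} [Bicategory.{w₂, v₂} D]
  (U : D ⥤ᵖ C)

/-- Whiskering of a triangle `α : f ⟶ y ≫ U k` by a 1-cell `U h`, normalized by `U`. -/
def whiskerExt {A : C} {X B B' : D} {y : A ⟶ U.obj X} {f : A ⟶ U.obj B} {k : X ⟶ B}
    (α : f ⟶ y ≫ U.map k) (h : B ⟶ B') : f ≫ U.map h ⟶ y ≫ U.map (k ≫ h) :=
  α ▷ U.map h ≫ (α_ y (U.map k) (U.map h)).hom ≫ y ◁ (U.mapComp k h).inv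

theorem whiskerLeft_map₂_hom_inv {A : C} {X B : D} (y : A ⟶ U.obj X) {k k' : X ⟶ B} (e : k ≅ k') :
    y ◁ U.map₂ e.hom ≫ y ◁ U.map₂ e.inv = 𝟙 _ := by
  rw [← whiskerLeft_comp, ← U.map₂_comp]; simp

theorem whiskerLeft_map₂_inv_hom {A : C} {X B : D} (y : A ⟶ U.obj X) {k k' : X ⟶ B} (e : k ≅ k') :
    y ◁ U.map₂ e.inv ≫ y ◁ U.map₂ e.hom = 𝟙 _ := by
  rw [← whiskerLeft_comp, ← U.map₂_comp]; simp

/-- Reduces the laws of `pasteExt` to those of `whiskerExt`, where the coherence of `U` enters. -/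
theorem pasteExt_eq_whiskerExt {A P : C} {X X' B : D} {y : A ⟶ U.obj X} {z : P ⟶ U.obj X'}
    {f : A ⟶ P} {v : P ⟶ U.obj B} {k : X ⟶ X'} {m : X' ⟶ B}
    (α : f ≫ z ⟶ y ≫ U.map k) (β : v ⟶ z ≫ U.map m) :
    pasteExt U α β = f ◁ β ≫ (α_ f z (U.map m)).inv ≫ whiskerExt U α m := rfl

theorem whiskerExt_comp_left {A : C} {X B B' : D} {y : A ⟶ U.obj X} {f f' : A ⟶ U.obj B}
    {k : X ⟶ B} (τ : f ⟶ f') (α : f' ⟶ y ≫ U.map k) (h : B ⟶ B') :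
    whiskerExt U (τ ≫ α) h = τ ▷ U.map h ≫ whiskerExt U α h := by
  simp [whiskerExt]

theorem whiskerExt_comp_map₂ {A : C} {X B B' : D} {y : A ⟶ U.obj X} {f : A ⟶ U.obj B}
    {k k' : X ⟶ B} (α : f ⟶ y ≫ U.map k) (κ : k ⟶ k') (h : B ⟶ B') :
    whiskerExt U (α ≫ y ◁ U.map₂ κ) h = whiskerExt U α h ≫ y ◁ U.map₂ (κ ▷ h) := by
  simp [whiskerExt, ← whiskerLeft_comp]

theorem whiskerLeft_map₂_whiskerExt {A : C} {X B B' : D} {y : A ⟶ U.obj X} {f : A ⟶ U.obj B}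
    {k : X ⟶ B} (α : f ⟶ y ≫ U.map k) {h h' : B ⟶ B'} (θ : h ⟶ h') :
    f ◁ U.map₂ θ ≫ whiskerExt U α h' = whiskerExt U α h ≫ y ◁ U.map₂ (k ◁ θ) := by
  simp [whiskerExt, ← whiskerLeft_comp, whisker_exchange_assoc]

/-- Associativity coherence of `U` merges the two constraints, and interchange moves the remaining
one in front of `α`. -/
theorem whiskerExt_whiskerExt {A : C} {X B B' B'' : D} {y : A ⟶ U.obj X} {f : A ⟶ U.obj B}
    {k : X ⟶ B} (α : f ⟶ y ≫ U.map k) (h : B ⟶ B') (h' : B' ⟶ B'') :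
    whiskerExt U (whiskerExt U α h) h' =
      (α_ _ _ _).hom ≫ f ◁ (U.mapComp h h').inv ≫ whiskerExt U α (h ≫ h') ≫
        y ◁ U.map₂ (α_ k h h').inv := by
  have e := U.mapComp_assoc_left_inv k h h'
  calc
    _ = 𝟙 _ ⊗≫ α ▷ U.map h ▷ U.map h' ⊗≫
      y ◁ ((U.mapComp k h).inv ▷ U.map h' ≫ (U.mapComp (k ≫ h) h').inv) := by
        simp only [whiskerExt]; bicategory
    _ = 𝟙 _ ⊗≫ (α ▷ (U.map h ≫ U.map h') ≫ _ ◁ (U.mapComp h h').inv) ⊗≫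
      y ◁ (U.mapComp k (h ≫ h')).inv ≫ y ◁ U.map₂ (α_ k h h').inv := by
        rw [e]; bicategory
    _ = _ := by
        rw [← whisker_exchange]; simp only [whiskerExt]; bicategory

theorem whiskerExt_id {A : C} {X B : D} {y : A ⟶ U.obj X} {f : A ⟶ U.obj B}
    {k : X ⟶ B} (α : f ⟶ y ≫ U.map k) :
    whiskerExt U α (𝟙 B) = f ◁ (U.mapId B).hom ≫ (ρ_ f).hom ≫ α ≫ y ◁ U.map₂ (ρ_ k).inv := by
  calc
    _ = (α ▷ U.map (𝟙 B) ≫ _ ◁ (U.mapId B).hom) ⊗≫ y ◁ U.map₂ (ρ_ k).inv := by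
      simp only [whiskerExt, U.mapComp_id_right_inv]; bicategory
    _ = _ := by
      rw [← whisker_exchange]; bicategory

section Paste

variable {A P : C} {X X' B : D} {y : A ⟶ U.obj X} {z : P ⟶ U.obj X'} {f : A ⟶ P}
  {v : P ⟶ U.obj B} {k : X ⟶ X'} {m : X' ⟶ B}

theorem pasteExt_comp_map₂_left {k' : X ⟶ X'} (α : f ≫ z ⟶ y ≫ U.map k) (κ : k ⟶ k')
    (β : v ⟶ z ≫ U.map m) :
    pasteExt U (α ≫ y ◁ U.map₂ κ) β = pasteExt U α β ≫ y ◁ U.map₂ (κ ▷ m) := by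
  simp only [pasteExt_eq_whiskerExt, whiskerExt_comp_map₂, Category.assoc]

theorem pasteExt_comp_map₂_right {m' : X' ⟶ B} (α : f ≫ z ⟶ y ≫ U.map k)
    (β : v ⟶ z ≫ U.map m) (μ : m ⟶ m') :
    pasteExt U α (β ≫ z ◁ U.map₂ μ) = pasteExt U α β ≫ y ◁ U.map₂ (k ◁ μ) := by
  simp only [pasteExt_eq_whiskerExt, whiskerLeft_comp, Category.assoc,
    ← whiskerLeft_map₂_whiskerExt]
  simp

theorem pasteExt_comp_left {f' : A ⟶ P} (τ : f ⟶ f') (α : f' ≫ z ⟶ y ≫ U.map k)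
    (β : v ⟶ z ≫ U.map m) :
    pasteExt U (τ ▷ z ≫ α) β = τ ▷ v ≫ pasteExt U α β := by
  rw [pasteExt_eq_whiskerExt, pasteExt_eq_whiskerExt, whiskerExt_comp_left,
    ← whisker_exchange_assoc]
  simp

theorem pasteExt_whiskerExt {B' : D} (α : f ≫ z ⟶ y ≫ U.map k) (β : v ⟶ z ≫ U.map m)
    (h : B ⟶ B') :
    pasteExt U α (whiskerExt U β h) =
      (α_ _ _ _).inv ≫ whiskerExt U (pasteExt U α β) h ≫ y ◁ U.map₂ (α_ k m h).hom := by
  have e : pasteExt U α β = (f ◁ β ≫ (α_ _ _ _).inv) ≫ whiskerExt U α m := by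
    simp [pasteExt_eq_whiskerExt]
  rw [e, whiskerExt_comp_left, whiskerExt_whiskerExt, pasteExt_eq_whiskerExt]
  simp only [Category.assoc, whiskerLeft_map₂_inv_hom, Category.comp_id]
  simp only [whiskerExt]
  bicategory

theorem pasteExt_comp_right {v' : P ⟶ U.obj B} (α : f ≫ z ⟶ y ≫ U.map k) (τ : v ⟶ v')
    (β : v' ⟶ z ≫ U.map m) :
    pasteExt U α (τ ≫ β) = f ◁ τ ≫ pasteExt U α β := by
  simp [pasteExt_eq_whiskerExt]

/-- Associativity of pasting. It yields the associativity axiom of `F` and the compatibility of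
`cell` and `ε` with composition. -/
theorem pasteExt_pasteExt {Q : C} {X'' : D} {z' : Q ⟶ U.obj X''} {g : P ⟶ Q} {w : Q ⟶ U.obj B}
    {l : X' ⟶ X''} {n : X'' ⟶ B} (α : f ≫ z ⟶ y ≫ U.map k) (β : g ≫ z' ⟶ z ≫ U.map l)
    (γ : w ⟶ z' ≫ U.map n) :
    pasteExt U α (pasteExt U β γ) =
      (α_ _ _ _).inv ≫ pasteExt U ((α_ _ _ _).hom ≫ pasteExt U α β) γ ≫
        y ◁ U.map₂ (α_ k l n).hom := by
  have e : pasteExt U β γ = (g ◁ γ ≫ (α_ _ _ _).inv) ≫ whiskerExt U β n := by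
    simp [pasteExt_eq_whiskerExt]
  rw [e, pasteExt_comp_right, pasteExt_whiskerExt, pasteExt_eq_whiskerExt _ (_ ≫ _),
    whiskerExt_comp_left]
  bicategory

theorem pasteExt_id_left {X B : D} {y : A ⟶ U.obj X} {v : A ⟶ U.obj B} {m : X ⟶ B}
    (β : v ⟶ y ≫ U.map m) :
    pasteExt U ((λ_ y).hom ≫ (ρ_ y).inv ≫ y ◁ (U.mapId X).inv) β =
      (λ_ v).hom ≫ β ≫ y ◁ U.map₂ (λ_ m).inv := by
  simp only [pasteExt, U.mapComp_id_left_inv]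
  calc
    _ = 𝟙 _ ⊗≫ (𝟙 A ◁ β ≫ (λ_ _).hom) ⊗≫ y ◁ ((U.mapId X).inv ≫ (U.mapId X).hom) ▷ U.map m ⊗≫
        y ◁ U.map₂ (λ_ m).inv := by bicategory
    _ = _ := by rw [Iso.inv_hom_id]; bicategory

theorem pasteExt_id_right (α : f ≫ z ⟶ y ≫ U.map k) :
    pasteExt U α ((ρ_ z).inv ≫ z ◁ (U.mapId X').inv) = α ≫ y ◁ U.map₂ (ρ_ k).inv := by
  rw [pasteExt_eq_whiskerExt, whiskerExt_id]
  calc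
    _ = 𝟙 _ ⊗≫ (f ≫ z) ◁ ((U.mapId X').inv ≫ (U.mapId X').hom) ⊗≫ α ≫ y ◁ U.map₂ (ρ_ k).inv := by
      bicategory
    _ = _ := by rw [Iso.inv_hom_id]; bicategory

theorem whiskerExt_id_triangle {X B : D} (y : A ⟶ U.obj X) (h : X ⟶ B) :
    whiskerExt U ((ρ_ y).inv ≫ y ◁ (U.mapId X).inv) h = y ◁ U.map₂ (λ_ h).inv := by
  simp only [whiskerExt, U.mapComp_id_left_inv]
  calc
    _ = 𝟙 _ ⊗≫ y ◁ ((U.mapId X).inv ≫ (U.mapId X).hom) ▷ U.map h ⊗≫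
        y ◁ U.map₂ (λ_ h).inv := by bicategory
    _ = _ := by rw [Iso.inv_hom_id]; bicategory

end Paste
end Calculus
end ColaxAdj

/-! ### Colax adjunctions through extension cells and transposes -/

namespace ColaxAdj
namespace ColaxAdjunctionData

variable {C : Type u₁} [Bicategory.{w₁, v₁} C] {D : Type u₂} [Bicategory.{w₂, v₂} D]
  {F : C ⥤ᵖ D} {U : D ⥤ᵖ C} (S : ColaxAdjunctionData F U)

theorem unitCell_naturality {A A' : C} {f f' : A ⟶ A'} (τ : f ⟶ f') :
    τ ▷ S.unitAt A' ≫ S.unitCell f' = S.unitCell f ≫ S.unitAt A ◁ U.map₂ (F.map₂ τ) :=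
  S.unit.naturality_naturality τ

theorem unitCell_comp {A A' A'' : C} (f : A ⟶ A') (g : A' ⟶ A'') :
    S.unitCell (f ≫ g) ≫ S.unitAt A ◁ U.map₂ (F.mapComp f g).hom =
      (α_ _ _ _).hom ≫ pasteExt U (S.unitCell f) (S.unitCell g) := by
  have h : S.unitCell (f ≫ g) ≫ S.unitAt A ◁ (U.map₂ (F.mapComp f g).hom ≫
      (U.mapComp (F.map f) (F.map g)).hom) =
    𝟙 (f ≫ g) ▷ S.unitAt A'' ≫ (α_ _ _ _).hom ≫ f ◁ S.unitCell g ≫ (α_ _ _ _).inv ≫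
      S.unitCell f ▷ U.map (F.map g) ≫ (α_ _ _ _).hom := S.unit.naturality_comp f g
  rw [whiskerLeft_comp] at h
  rw [← cancel_mono (S.unitAt A ◁ (U.mapComp (F.map f) (F.map g)).hom), Category.assoc, h]
  simp [pasteExt]

theorem unitCell_id (A : C) :
    S.unitCell (𝟙 A) ≫ S.unitAt A ◁ U.map₂ (F.mapId A).hom =
      (λ_ _).hom ≫ (ρ_ _).inv ≫ S.unitAt A ◁ (U.mapId _).inv := by
  have h : S.unitCell (𝟙 A) ≫ S.unitAt A ◁ (U.map₂ (F.mapId A).hom ≫ (U.mapId _).hom) =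
      𝟙 (𝟙 A) ▷ S.unitAt A ≫ (λ_ _).hom ≫ (ρ_ _).inv := S.unit.naturality_id A
  rw [whiskerLeft_comp] at h
  rw [← cancel_mono (S.unitAt A ◁ (U.mapId _).hom), Category.assoc, h]
  simp

theorem counitCell_naturality {B B' : D} {h h' : B ⟶ B'} (θ : h ⟶ h') :
    F.map₂ (U.map₂ θ) ▷ S.counitAt B' ≫ S.counitCell h' = S.counitCell h ≫ S.counitAt B ◁ θ :=
  S.counit.naturality_naturality θ

theorem counitCell_comp {B B' B'' : D} (h : B ⟶ B') (k : B' ⟶ B'') :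
    S.counitCell (h ≫ k) =
      (F.map₂ (U.mapComp h k).hom ≫ (F.mapComp _ _).hom) ▷ S.counitAt B'' ≫ (α_ _ _ _).hom ≫
        F.map (U.map h) ◁ S.counitCell k ≫ (α_ _ _ _).inv ≫
          S.counitCell h ▷ k ≫ (α_ _ _ _).hom := by
  have h : S.counitCell (h ≫ k) ≫ S.counitAt B ◁ 𝟙 (h ≫ k) =
      (F.map₂ (U.mapComp h k).hom ≫ (F.mapComp _ _).hom) ▷ S.counitAt B'' ≫ (α_ _ _ _).hom ≫
        F.map (U.map h) ◁ S.counitCell k ≫ (α_ _ _ _).inv ≫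
          S.counitCell h ▷ k ≫ (α_ _ _ _).hom := S.counit.naturality_comp h k
  rw [← h]; simp

/-- The extension cell `f ⟶ η ≫ U (F f ≫ ε)`. -/
def cell {A : C} {B : D} (f : A ⟶ U.obj B) :
    f ⟶ S.unitAt A ≫ U.map (F.map f ≫ S.counitAt B) :=
  (ρ_ f).inv ≫ pasteExt U (S.unitCell f) (S.Φ B)

/-- The transpose of `α : f ⟶ η ≫ U g`. -/
def transpose {A : C} {B : D} {f : A ⟶ U.obj B} {g : F.obj A ⟶ B} (α : f ⟶ S.unitAt A ≫ U.map g) :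
    F.map f ≫ S.counitAt B ⟶ g :=
  (F.map₂ α ≫ (F.mapComp _ _).hom) ▷ S.counitAt B ≫ (α_ _ _ _).hom ≫
    F.map (S.unitAt A) ◁ S.counitCell g ≫ (α_ _ _ _).inv ≫ S.Ψ A ▷ g ≫ (λ_ g).hom

/-- Cancelling the invertible constraint of `U` puts the law in the form `f ⟶ y ≫ U g`, in which a
universal property can solve it for `ε_h`. -/
theorem phiIsModification_iff : S.PhiIsModification ↔ ∀ {B B' : D} (h : B ⟶ B'),
    pasteExt U (S.unitCell (U.map h)) (S.Φ B') ≫ S.unitAt _ ◁ U.map₂ (S.counitCell h) =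
      (ρ_ _).hom ≫ (λ_ _).inv ≫ whiskerExt U (S.Φ B) h := by
  refine forall_congr' fun B ↦ forall_congr' fun B' ↦ forall_congr' fun h ↦ ?_
  rw [← cancel_mono ((α_ _ _ _).hom ≫ S.unitAt (U.obj B) ◁ (U.mapComp (S.counitAt B) h).inv)]
  have e : (U.map h ◁ S.Φ B' ≫ pasteSquares (S.unitCell (U.map h)) (mapSquare U (S.counitCell h))) ≫
      ((α_ _ _ _).hom ≫ S.unitAt (U.obj B) ◁ (U.mapComp (S.counitAt B) h).inv) =
      pasteExt U (S.unitCell (U.map h)) (S.Φ B') ≫ S.unitAt _ ◁ U.map₂ (S.counitCell h) := by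
    simp [pasteSquares, mapSquare, pasteExt]
  rw [e]
  simp [whiskerExt]

theorem swallowtailUnit_iff : S.SwallowtailUnit ↔ ∀ A : C,
    S.cell (S.unitAt A) ≫ S.unitAt A ◁ U.map₂ (S.Ψ A) =
      (ρ_ (S.unitAt A)).inv ≫ S.unitAt A ◁ (U.mapId _).inv := by
  refine forall_congr' fun A ↦ ?_
  rw [← cancel_mono (S.unitAt A ◁ (U.mapId _).hom ≫ (ρ_ _).hom)]
  simp [cell, pasteExt, UΨ]

theorem pasteExt_unitCell_Φ {A : C} {B : D} (f : A ⟶ U.obj B) :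
    pasteExt U (S.unitCell f) (S.Φ B) = (ρ_ f).hom ≫ S.cell f := by
  simp [cell]

theorem comp_cell {A : C} {B : D} {f f' : A ⟶ U.obj B} (τ : f ⟶ f') :
    τ ≫ S.cell f' = S.cell f ≫ S.unitAt A ◁ U.map₂ (F.map₂ τ ▷ S.counitAt B) := by
  simp only [cell, Category.assoc]
  rw [← pasteExt_comp_map₂_left, ← unitCell_naturality, pasteExt_comp_left]
  simp

/-- Compatibility of `η` with composition, followed by associativity of pasting. -/
theorem cell_comp {A P : C} {B : D} (f : A ⟶ P) (v : P ⟶ U.obj B) :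
    S.cell (f ≫ v) ≫ S.unitAt A ◁ U.map₂ ((F.mapComp f v).hom ▷ S.counitAt B ≫ (α_ _ _ _).hom) =
      pasteExt U (S.unitCell f) (S.cell v) := by
  simp only [cell, Category.assoc, U.map₂_comp, whiskerLeft_comp]
  rw [← reassoc_of% pasteExt_comp_map₂_left, unitCell_comp, pasteExt_comp_right, pasteExt_pasteExt]
  simp

/-- The existence half of the universal property. Naturality moves `α` to the front, the `Φ` law
trades `ε_g` for a whiskering of `Φ` by `g`, and the swallowtail on `η` cancels that `Φ` against
`Ψ`. No law of `Ψ` or swallowtail on `ε` is needed, so the lemma is available while those are still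
being proved in the converse direction. -/
theorem cell_comp_transpose (hΦ : S.PhiIsModification) (hS : S.SwallowtailUnit)
    {A : C} {B : D} {f : A ⟶ U.obj B} {g : F.obj A ⟶ B} (α : f ⟶ S.unitAt A ≫ U.map g) :
    S.cell f ≫ S.unitAt A ◁ U.map₂ (S.transpose α) = α := by
  rw [phiIsModification_iff] at hΦ
  rw [swallowtailUnit_iff] at hS
  have e : S.transpose α = F.map₂ α ▷ S.counitAt B ≫
      ((F.mapComp _ _).hom ▷ S.counitAt B ≫ (α_ _ _ _).hom) ≫
    F.map (S.unitAt A) ◁ S.counitCell g ≫ (α_ _ _ _).inv ≫ S.Ψ A ▷ g ≫ (λ_ g).hom := by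
    simp [transpose]
  rw [e]
  simp only [U.map₂_comp _ (_ ≫ _), whiskerLeft_comp _ _ (_ ≫ _)]
  rw [← reassoc_of% comp_cell, reassoc_of% cell_comp, ← reassoc_of% pasteExt_comp_map₂_right]
  have e2 : S.cell (U.map g) ≫ S.unitAt _ ◁ U.map₂ (S.counitCell g) =
      (λ_ _).inv ≫ whiskerExt U (S.Φ _) g := by
    simp only [cell, Category.assoc, hΦ, Iso.inv_hom_id_assoc]
  have e3 : whiskerExt U (S.cell (S.unitAt A)) g ≫ S.unitAt A ◁ U.map₂ (S.Ψ A ▷ g) =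
      S.unitAt A ◁ U.map₂ (λ_ g).inv := by
    rw [← whiskerExt_comp_map₂, hS, whiskerExt_id_triangle]
  rw [e2, pasteExt_comp_right, pasteExt_whiskerExt, pasteExt_unitCell_Φ, whiskerExt_comp_left]
  simp only [U.map₂_comp (S.Ψ A ▷ g), whiskerLeft_comp _ _ (_ ≫ _),
    whiskerLeft_comp _ (U.map₂ (S.Ψ A ▷ g)), Category.assoc, reassoc_of% whiskerLeft_map₂_hom_inv,
    reassoc_of% e3, whiskerLeft_map₂_inv_hom]
  simp

theorem transpose_unitCell_iff {A A' : C} (f : A ⟶ A') :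
    S.transpose (S.unitCell f) = (F.mapComp _ _).hom ▷ S.counitAt _ ≫ (α_ _ _ _).hom ≫
        F.map f ◁ S.Ψ A' ≫ (ρ_ _).hom ↔
    F.map f ◁ S.Ψ A' ≫ (ρ_ (F.map f)).hom ≫ (λ_ (F.map f)).inv =
      pasteSquares (mapSquare F (S.unitCell f)) (S.counitCell (F.map f)) ≫ S.Ψ A ▷ F.map f := by
  rw [← cancel_epi ((F.mapComp f (S.unitAt A')).hom ▷ S.counitAt (F.obj A') ≫ (α_ _ _ _).hom),
    ← cancel_mono (λ_ (F.map f)).hom]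
  simp only [pasteSquares, mapSquare, transpose, Category.assoc, comp_whiskerRight,
    Iso.inv_hom_id, Category.comp_id, Iso.hom_inv_id_assoc, hom_inv_whiskerRight_assoc]
  exact eq_comm

/-- In this form the law shows that `transpose η_f` is invertible whenever `Ψ` is. -/
theorem psiIsModification_iff : S.PsiIsModification ↔ ∀ {A A' : C} (f : A ⟶ A'),
    S.transpose (S.unitCell f) = (F.mapComp _ _).hom ▷ S.counitAt _ ≫ (α_ _ _ _).hom ≫
        F.map f ◁ S.Ψ A' ≫ (ρ_ _).hom :=
  forall_congr' fun _ ↦ forall_congr' fun _ ↦ forall_congr' fun f ↦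
    (S.transpose_unitCell_iff f).symm

theorem swallowtailCounit_iff : S.SwallowtailCounit ↔ ∀ B : D,
    S.transpose (S.Φ B) = (F.mapId _).hom ▷ S.counitAt B ≫ (λ_ _).hom := by
  refine forall_congr' fun B ↦ ?_
  rw [← cancel_epi ((λ_ _).inv ≫ (F.mapId (U.obj B)).inv ▷ S.counitAt B)]
  simp [transpose, FΦ]

end ColaxAdjunctionData
end ColaxAdj

/-! ### From a colax adjunction to left `U`-extensions -/

namespace ColaxAdj

section

variable {C : Type u₁} [Bicategory.{w₁, v₁} C] {D : Type u₂} [Bicategory.{w₂, v₂} D]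
  {U : D ⥤ᵖ C}

namespace IsLeftUExtension

variable {A : C} {X B : D} {y : A ⟶ U.obj X} {f f' : A ⟶ U.obj B} {k k' : X ⟶ B}
  {ψ : f ⟶ y ≫ U.map k}

theorem comp_iso_iff (e : k ≅ k') :
    IsLeftUExtension U y f k' (ψ ≫ y ◁ U.map₂ e.hom) ↔ IsLeftUExtension U y f k ψ := by
  have aux {g : X ⟶ B} (θ : k' ⟶ g) :
      (ψ ≫ y ◁ U.map₂ e.hom) ≫ y ◁ U.map₂ θ = ψ ≫ y ◁ U.map₂ (e.hom ≫ θ) := by simp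
  refine forall_congr' fun g ↦ forall_congr' fun α ↦ ⟨?_, ?_⟩
  · rintro ⟨θ, h, hθ⟩
    refine ⟨e.hom ≫ θ, (aux θ).symm.trans h, fun θ' h' ↦ ?_⟩
    rw [← hθ (e.inv ≫ θ') ((aux _).trans (by simpa using h')), Iso.hom_inv_id_assoc]
  · rintro ⟨θ, h, hθ⟩
    refine ⟨e.inv ≫ θ, (aux _).trans (by simpa using h), fun θ' h' ↦ ?_⟩
    rw [← hθ (e.hom ≫ θ') ((aux θ').symm.trans h'), Iso.inv_hom_id_assoc]

theorem iso_comp_iff (τ : f' ≅ f) :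
    IsLeftUExtension U y f' k (τ.hom ≫ ψ) ↔ IsLeftUExtension U y f k ψ := by
  refine forall_congr' fun g ↦ ⟨fun H α ↦ ?_, fun H α ↦ ?_⟩
  · simpa using H (τ.hom ≫ α)
  · simpa [Iso.eq_inv_comp] using H (τ.inv ≫ α)

end IsLeftUExtension

namespace ColaxAdjunctionData

variable {F : C ⥤ᵖ D} (S : ColaxAdjunctionData F U)

theorem transpose_comp_left {A : C} {B : D} {f f' : A ⟶ U.obj B} {g : F.obj A ⟶ B} (τ : f ⟶ f')
    (α : f' ⟶ S.unitAt A ≫ U.map g) :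
    S.transpose (τ ≫ α) = F.map₂ τ ▷ S.counitAt B ≫ S.transpose α := by
  simp [transpose]

theorem transpose_comp_map₂ {A : C} {B : D} {f : A ⟶ U.obj B} {g g' : F.obj A ⟶ B}
    (α : f ⟶ S.unitAt A ≫ U.map g) (θ : g ⟶ g') :
    S.transpose (α ≫ S.unitAt A ◁ U.map₂ θ) = S.transpose α ≫ θ := by
  have e : F.map (S.unitAt A) ◁ F.map₂ (U.map₂ θ) ▷ S.counitAt B ≫
      F.map (S.unitAt A) ◁ S.counitCell g' =
      F.map (S.unitAt A) ◁ S.counitCell g ≫ F.map (S.unitAt A) ◁ S.counitAt _ ◁ θ := by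
    rw [← whiskerLeft_comp, counitCell_naturality, whiskerLeft_comp]
  simp only [transpose, comp_whiskerRight,
    Pseudofunctor.map₂_whisker_left, F.map₂_comp, Category.assoc, Iso.inv_hom_id, Category.comp_id,
    whisker_assoc, Iso.inv_hom_id_assoc, reassoc_of% e]
  rw [associator_inv_naturality_right_assoc, whisker_exchange_assoc, leftUnitor_naturality]

theorem transpose_whiskerExt {A : C} {B B' : D} {f : A ⟶ U.obj B} {g : F.obj A ⟶ B}
    (α : f ⟶ S.unitAt A ≫ U.map g) (h : B ⟶ B') :
    S.transpose (whiskerExt U α h) = (F.mapComp _ _).hom ▷ S.counitAt B' ≫ (α_ _ _ _).hom ≫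
      F.map f ◁ S.counitCell h ≫ (α_ _ _ _).inv ≫ S.transpose α ▷ h := by
  have e : F.map (S.unitAt A) ◁ F.map₂ (U.mapComp g h).inv ▷ S.counitAt B' ≫
      F.map (S.unitAt A) ◁ F.map₂ (U.mapComp g h).hom ▷ S.counitAt B' = 𝟙 _ := by
    rw [← whiskerLeft_comp, ← comp_whiskerRight, ← F.map₂_comp]; simp
  simp [transpose, whiskerExt, counitCell_comp, reassoc_of% e]
  -- Interchange slides `ε_h` past `F α`.
  have ex := whisker_exchange (F.map₂ α ≫ (F.mapComp (S.unitAt A) (U.map g)).hom)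
    (S.counitCell h)
  calc
    _ = (F.mapComp f (U.map h)).hom ▷ S.counitAt B' ≫ (α_ _ _ _).hom ≫
        ((F.map₂ α ≫ (F.mapComp (S.unitAt A) (U.map g)).hom) ▷ (F.map (U.map h) ≫ S.counitAt B') ≫
          (F.map (S.unitAt A) ≫ F.map (U.map g)) ◁ S.counitCell h) ⊗≫
        F.map (S.unitAt A) ◁ S.counitCell g ▷ h ⊗≫ S.Ψ A ▷ g ▷ h ⊗≫ 𝟙 _ := by bicategory
    _ = _ := by rw [← ex]; bicategory

/-- The uniqueness half: with `transpose_comp_map₂`, any `θ` equals the transpose of its pasting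
with `cell f`. -/
theorem transpose_cell (hΨ : S.PsiIsModification) (hS : S.SwallowtailCounit)
    {A : C} {B : D} (f : A ⟶ U.obj B) : S.transpose (S.cell f) = 𝟙 _ := by
  rw [psiIsModification_iff] at hΨ
  rw [swallowtailCounit_iff] at hS
  have e : S.cell f = ((ρ_ f).inv ≫ f ◁ S.Φ B ≫ (α_ _ _ _).inv) ≫
      whiskerExt U (S.unitCell f) (S.counitAt B) := by
    simp [cell, pasteExt_eq_whiskerExt]
  -- The swallowtail on `ε`, whiskered by `F f`. Expanding the goal's identity into it leaves only
  -- coherence of `F` and one interchange.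
  have h : F.map f ◁ (((λ_ (S.counitAt B)).inv ≫ (F.mapId (U.obj B)).inv ▷ S.counitAt B) ≫
      S.transpose (S.Φ B)) = 𝟙 _ := by
    rw [hS]; simp
  have hρ : F.map₂ (ρ_ f).inv ≫ (F.mapComp f (𝟙 _)).hom =
      (ρ_ _).inv ≫ F.map f ◁ (F.mapId _).inv := by
    rw [F.mapComp_id_right_hom, ← F.map₂_comp_assoc]; simp
  have hα : (F.mapComp f (S.unitAt (U.obj B) ≫ U.map (S.counitAt B))).inv ≫
      F.map₂ (α_ f (S.unitAt (U.obj B)) (U.map (S.counitAt B))).inv ≫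
      (F.mapComp (f ≫ S.unitAt (U.obj B)) (U.map (S.counitAt B))).hom =
      F.map f ◁ (F.mapComp _ _).hom ≫ (α_ _ _ _).inv ≫
        (F.mapComp f (S.unitAt (U.obj B))).inv ▷ F.map (U.map (S.counitAt B)) := by
    rw [Iso.inv_comp_eq, F.mapComp_assoc_right_hom_assoc]; simp
  have ex := whisker_exchange (F.mapComp f (S.unitAt (U.obj B))).inv (S.counitCell (S.counitAt B))
  rw [e, transpose_comp_left, transpose_whiskerExt, hΨ, ← h]
  calc
    _ = (F.map₂ (ρ_ f).inv ≫ (F.mapComp f (𝟙 _)).hom) ▷ S.counitAt B ≫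
          (F.map f ◁ F.map₂ (S.Φ B)) ▷ S.counitAt B ≫
          ((F.mapComp f (S.unitAt (U.obj B) ≫ U.map (S.counitAt B))).inv ≫
            F.map₂ (α_ f (S.unitAt (U.obj B)) (U.map (S.counitAt B))).inv ≫
            (F.mapComp (f ≫ S.unitAt (U.obj B)) (U.map (S.counitAt B))).hom) ▷ S.counitAt B ⊗≫
          F.map (f ≫ S.unitAt (U.obj B)) ◁ S.counitCell (S.counitAt B) ⊗≫
          (F.mapComp f (S.unitAt (U.obj B))).hom ▷ S.counitAt (F.obj (U.obj B)) ▷ S.counitAt B ⊗≫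
          F.map f ◁ S.Ψ (U.obj B) ▷ S.counitAt B ⊗≫ 𝟙 _ := by
      simp only [F.map₂_comp, Pseudofunctor.map₂_whisker_left]; bicategory
    _ = 𝟙 _ ⊗≫ F.map f ◁ ((F.mapId _).inv ▷ S.counitAt B ≫ F.map₂ (S.Φ B) ▷ S.counitAt B ≫
          (F.mapComp _ _).hom ▷ S.counitAt B) ⊗≫
          ((F.mapComp f (S.unitAt (U.obj B))).inv ▷ (F.map (U.map (S.counitAt B)) ≫ S.counitAt B) ≫
          F.map (f ≫ S.unitAt (U.obj B)) ◁ S.counitCell (S.counitAt B)) ⊗≫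
          (F.mapComp f (S.unitAt (U.obj B))).hom ▷ S.counitAt (F.obj (U.obj B)) ▷ S.counitAt B ⊗≫
          F.map f ◁ S.Ψ (U.obj B) ▷ S.counitAt B ⊗≫ 𝟙 _ := by
      rw [hρ, hα]; bicategory
    _ = 𝟙 _ ⊗≫ F.map f ◁ ((F.mapId _).inv ▷ S.counitAt B ≫ F.map₂ (S.Φ B) ▷ S.counitAt B ≫
          (F.mapComp _ _).hom ▷ S.counitAt B) ⊗≫
          (F.map f ≫ F.map (S.unitAt (U.obj B))) ◁ S.counitCell (S.counitAt B) ⊗≫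
          ((F.mapComp f (S.unitAt (U.obj B))).inv ≫ (F.mapComp f (S.unitAt (U.obj B))).hom) ▷
            S.counitAt (F.obj (U.obj B)) ▷ S.counitAt B ⊗≫
          F.map f ◁ S.Ψ (U.obj B) ▷ S.counitAt B ⊗≫ 𝟙 _ := by
      rw [← ex]; bicategory
    _ = _ := by
      rw [Iso.inv_hom_id]; simp only [transpose]; bicategory

end ColaxAdjunctionData

theorem exists_choice_of_colaxAdjunction {F : C ⥤ᵖ D} (S : ColaxAdjunction F U)
    (hiso : ∀ A, IsIso (S.Ψ A)) : ∃ E : UExtensionChoice U S.unitAt,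
        E.IsCoherent ∧ UnitAxiom U S.unitAt ∧ E.CompositionAxiom := by
  have key {A : C} {B : D} {f : A ⟶ U.obj B} {g : F.obj A ⟶ B} (α : f ⟶ S.unitAt A ≫ U.map g) :
      S.cell f ≫ S.unitAt A ◁ U.map₂ (S.transpose α) = α :=
    S.cell_comp_transpose S.phi_modification S.swallowtail_unit α
  have hcell {A : C} {B : D} (f : A ⟶ U.obj B) :
      IsLeftUExtension U (S.unitAt A) f (F.map f ≫ S.counitAt B) (S.cell f) := fun g α ↦ by
    refine ⟨S.transpose α, key α, ?_⟩
    rintro θ rfl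
    rw [S.transpose_comp_map₂, S.transpose_cell S.psi_modification S.swallowtail_counit,
      Category.id_comp]
  have isoη {A A' : C} (f : A ⟶ A') : IsIso (S.transpose (S.unitCell f)) := by
    rw [S.psiIsModification_iff.1 S.psi_modification]; infer_instance
  have isoΦ (B : D) : IsIso (S.transpose (S.Φ B)) := by
    rw [S.swallowtailCounit_iff.1 S.swallowtail_counit]; infer_instance
  refine ⟨⟨_, S.cell, hcell⟩, fun {X Y} f ↦ ?_, fun A ↦ ?_, fun {A B C'} f g ↦ ?_⟩
  -- The chosen extensions are `F (f ≫ η) ≫ ε` and `F 𝟙 ≫ ε`; the transposes of `η_f` and `Φ`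
  -- identify them with `F f` and `ε`, turning the pasting into `cell f`.
  · rw [← IsLeftUExtension.comp_iso_iff
      (whiskerRightIso (asIso (S.transpose (S.unitCell f))) _ ≪≫
        whiskerLeftIso _ (asIso (S.transpose (S.Φ Y))))]
    convert hcell f using 1
    simp only [ColaxAdjunctionData.cell, Iso.trans_hom, whiskerRightIso_hom, whiskerLeftIso_hom,
      asIso_hom, U.map₂_comp, whiskerLeft_comp, Category.assoc]
    rw [← reassoc_of% pasteExt_comp_map₂_left, ← pasteExt_comp_map₂_right]
    exact congr(_ ≫ pasteExt U $(key _) $(key _))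
  · rw [← S.swallowtailUnit_iff.1 S.swallowtail_unit]
    exact (IsLeftUExtension.comp_iso_iff (asIso (S.Ψ A))).2 (hcell _)
  · rw [← IsLeftUExtension.comp_iso_iff
      (whiskerRightIso (asIso (S.transpose (S.unitCell f))) _ ≪≫
        whiskerLeftIso _ (asIso (S.transpose (S.unitCell g)))),
      ← IsLeftUExtension.iso_comp_iff (α_ _ _ _)]
    have h := (IsLeftUExtension.comp_iso_iff
      (asIso (S.transpose (S.unitCell (f ≫ g))) ≪≫ F.mapComp f g)).2 (hcell _)
    convert h using 1
    simp only [Iso.trans_hom, whiskerRightIso_hom, whiskerLeftIso_hom,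
      asIso_hom, U.map₂_comp, whiskerLeft_comp]
    rw [← reassoc_of% pasteExt_comp_map₂_left, ← pasteExt_comp_map₂_right, key, key,
      reassoc_of% key,
      S.unitCell_comp]

end
end ColaxAdj

/-! ### From left `U`-extensions to a pseudofunctor and its unit -/

namespace ColaxAdj

section

variable {C : Type u₁} [Bicategory.{w₁, v₁} C] {D : Type u₂} [Bicategory.{w₂, v₂} D]
  {U : D ⥤ᵖ C}

namespace IsLeftUExtension

variable {A : C} {X B : D} {y : A ⟶ U.obj X} {f : A ⟶ U.obj B} {k k' g : X ⟶ B}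
  {ψ : f ⟶ y ≫ U.map k} {ψ' : f ⟶ y ≫ U.map k'}

/-- The 2-cell out of a left `U`-extension induced by its universal property. -/
noncomputable def desc (H : IsLeftUExtension U y f k ψ) (α : f ⟶ y ≫ U.map g) : k ⟶ g :=
  (H g α).choose

theorem fac (H : IsLeftUExtension U y f k ψ) (α : f ⟶ y ≫ U.map g) :
    ψ ≫ y ◁ U.map₂ (H.desc α) = α :=
  (H g α).choose_spec.1

theorem hom_ext (H : IsLeftUExtension U y f k ψ) {θ θ' : k ⟶ g}
    (h : ψ ≫ y ◁ U.map₂ θ = ψ ≫ y ◁ U.map₂ θ') : θ = θ' :=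
  (H g _).unique h rfl

/-- Two left `U`-extensions of the same 1-cell are isomorphic. -/
noncomputable def iso (H : IsLeftUExtension U y f k ψ) (H' : IsLeftUExtension U y f k' ψ') :
    k ≅ k' where
  hom := H.desc ψ'
  inv := H'.desc ψ
  hom_inv_id := H.hom_ext (by simp [reassoc_of% fac, fac])
  inv_hom_id := H'.hom_ext (by simp [reassoc_of% fac, fac])

end IsLeftUExtension

namespace UExtensionChoice

variable {F₀ : C → D} {y : ∀ A : C, A ⟶ U.obj (F₀ A)} (E : UExtensionChoice U y)

/-- The chosen extension of `f ≫ y` is the action of the left adjoint on 1-cells. -/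
abbrev map {A B : C} (f : A ⟶ B) : F₀ A ⟶ F₀ B := E.ext (f ≫ y B)

/-- The 2-cell component of the unit. -/
abbrev unitCell {A B : C} (f : A ⟶ B) : f ≫ y B ⟶ y A ≫ U.map (E.map f) := E.cell (f ≫ y B)

theorem isLeftUExtension_unitCell {A B : C} (f : A ⟶ B) :
    IsLeftUExtension U (y A) (f ≫ y B) (E.map f) (E.unitCell f) := E.isLeftUExtension _

/-- The action of the left adjoint on 2-cells. -/
noncomputable def map₂ {A B : C} {f g : A ⟶ B} (τ : f ⟶ g) : E.map f ⟶ E.map g :=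
  (E.isLeftUExtension_unitCell f).desc (τ ▷ y B ≫ E.unitCell g)

theorem unitCell_map₂ {A B : C} {f g : A ⟶ B} (τ : f ⟶ g) :
    E.unitCell f ≫ y A ◁ U.map₂ (E.map₂ τ) = τ ▷ y B ≫ E.unitCell g :=
  IsLeftUExtension.fac _ _

/-- The unit constraint of the left adjoint. -/
noncomputable def mapId (A : C) : E.map (𝟙 A) ⟶ 𝟙 (F₀ A) :=
  (E.isLeftUExtension_unitCell (𝟙 A)).desc ((λ_ _).hom ≫ (ρ_ _).inv ≫ y A ◁ (U.mapId _).inv)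

theorem unitCell_mapId (A : C) :
    E.unitCell (𝟙 A) ≫ y A ◁ U.map₂ (E.mapId A) =
      (λ_ _).hom ≫ (ρ_ _).inv ≫ y A ◁ (U.mapId _).inv :=
  IsLeftUExtension.fac _ _

/-- The composition constraint of the left adjoint. -/
noncomputable def mapComp {A B B' : C} (f : A ⟶ B) (g : B ⟶ B') :
    E.map (f ≫ g) ⟶ E.map f ≫ E.map g :=
  (E.isLeftUExtension_unitCell (f ≫ g)).desc
    ((α_ _ _ _).hom ≫ pasteExt U (E.unitCell f) (E.unitCell g))

theorem unitCell_mapComp {A B B' : C} (f : A ⟶ B) (g : B ⟶ B') :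
    E.unitCell (f ≫ g) ≫ y A ◁ U.map₂ (E.mapComp f g) =
      (α_ _ _ _).hom ≫ pasteExt U (E.unitCell f) (E.unitCell g) :=
  IsLeftUExtension.fac _ _

/-- The left adjoint as an oplax functor. -/
noncomputable def oplaxFunctor : C ⥤ᵒᵖᴸ D where
  obj := F₀
  map := E.map
  map₂ := E.map₂
  -- Each axiom equates 2-cells out of some `E.map f`, so it is tested after pasting with
  -- `E.unitCell f`, where it becomes a law of `pasteExt`.
  map₂_id f := (E.isLeftUExtension_unitCell f).hom_ext (by simp [unitCell_map₂])
  map₂_comp τ τ' := (E.isLeftUExtension_unitCell _).hom_ext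
    (by simp [unitCell_map₂, reassoc_of% unitCell_map₂])
  mapId := E.mapId
  mapComp := E.mapComp
  mapComp_naturality_left {A B B' f f'} τ g := (E.isLeftUExtension_unitCell _).hom_ext (by
    simp only [U.map₂_comp, whiskerLeft_comp]
    rw [reassoc_of% unitCell_map₂, unitCell_mapComp, reassoc_of% unitCell_mapComp,
      ← pasteExt_comp_map₂_left, unitCell_map₂, pasteExt_comp_left]
    simp)
  mapComp_naturality_right {A B B'} f g g' τ := (E.isLeftUExtension_unitCell _).hom_ext (by
    simp only [U.map₂_comp, whiskerLeft_comp]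
    rw [reassoc_of% unitCell_map₂, unitCell_mapComp, reassoc_of% unitCell_mapComp,
      ← pasteExt_comp_map₂_right, unitCell_map₂, pasteExt_comp_right]
    simp)
  map₂_associator f g h := (E.isLeftUExtension_unitCell _).hom_ext (by
    simp only [U.map₂_comp, whiskerLeft_comp]
    rw [reassoc_of% unitCell_map₂, reassoc_of% unitCell_mapComp, reassoc_of% unitCell_mapComp,
      ← pasteExt_comp_map₂_right, ← reassoc_of% pasteExt_comp_map₂_left,
      unitCell_mapComp, unitCell_mapComp, pasteExt_comp_right, pasteExt_pasteExt]
    simp)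
  map₂_leftUnitor f := (E.isLeftUExtension_unitCell _).hom_ext (by
    simp only [U.map₂_comp, whiskerLeft_comp]
    rw [unitCell_map₂, reassoc_of% unitCell_mapComp, ← reassoc_of% pasteExt_comp_map₂_left,
      unitCell_mapId, pasteExt_id_left]
    -- The image of the unitor under `U` stays unexpanded so that it cancels its inverse.
    simp [whiskerLeft_map₂_inv_hom, -Pseudofunctor.map₂_left_unitor])
  map₂_rightUnitor f := (E.isLeftUExtension_unitCell _).hom_ext (by
    simp only [U.map₂_comp, whiskerLeft_comp]
    rw [unitCell_map₂, reassoc_of% unitCell_mapComp, ← reassoc_of% pasteExt_comp_map₂_right,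
      unitCell_mapId, pasteExt_comp_right, pasteExt_id_right]
    simp [whiskerLeft_map₂_inv_hom, -Pseudofunctor.map₂_right_unitor])

variable {E} (hunit : UnitAxiom U y) (hcomp : E.CompositionAxiom)

/-- The left adjoint as a pseudofunctor. -/
noncomputable def pseudofunctor : C ⥤ᵖ D :=
  Pseudofunctor.mkOfOplax E.oplaxFunctor
    -- The axioms make source and target of each constraint extensions of the same 1-cell, up to a
    -- unitor or associator.
    { mapIdIso A := (E.isLeftUExtension_unitCell (𝟙 A)).iso
        ((IsLeftUExtension.iso_comp_iff (λ_ _)).2 (hunit A))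
      mapCompIso f g := (E.isLeftUExtension_unitCell (f ≫ g)).iso
        ((IsLeftUExtension.iso_comp_iff (α_ _ _ _)).2 (hcomp f g))
      mapIdIso_hom := rfl
      mapCompIso_hom _ _ := rfl }

/-- The unit. -/
noncomputable def unit : Oplax.OplaxTrans (Pseudofunctor.id C).toOplax
    ((pseudofunctor hunit hcomp).comp U).toOplax where
  app := y
  naturality := E.unitCell
  naturality_naturality τ := (E.unitCell_map₂ τ).symm
  naturality_id A := by
    change E.unitCell (𝟙 A) ≫ y A ◁ (U.map₂ (E.mapId A) ≫ (U.mapId _).hom) =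
      𝟙 (𝟙 A) ▷ y A ≫ (λ_ _).hom ≫ (ρ_ _).inv
    rw [whiskerLeft_comp, reassoc_of% unitCell_mapId]
    simp
  naturality_comp f g := by
    change E.unitCell (f ≫ g) ≫ y _ ◁ (U.map₂ (E.mapComp f g) ≫
        (U.mapComp (E.map f) (E.map g)).hom) =
      𝟙 (f ≫ g) ▷ y _ ≫ (α_ _ _ _).hom ≫ f ◁ E.unitCell g ≫ (α_ _ _ _).inv ≫
        E.unitCell f ▷ U.map (E.map g) ≫ (α_ _ _ _).hom
    rw [whiskerLeft_comp, reassoc_of% unitCell_mapComp]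
    simp [pasteExt]

/-! ### Counit, modifications and swallowtail identities -/

variable (hcoh : E.IsCoherent)

variable (E) in
/-- The component of the counit. -/
abbrev counitAt (B : D) : F₀ (U.obj B) ⟶ B := E.ext (𝟙 (U.obj B))

variable (E) in
/-- The second component of the adjunction. -/
abbrev phi (B : D) : 𝟙 (U.obj B) ⟶ y (U.obj B) ≫ U.map (E.counitAt B) := E.cell (𝟙 (U.obj B))

-- Coherence moved from `f` to `f ≫ 𝟙`, the source of the bare pasting; it defines and compares
-- 2-cells out of `E.map f ≫ E.counitAt B`.
include hcoh in
theorem isLeftUExtension_pasteExt {A : C} {B : D} (f : A ⟶ U.obj B) :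
    IsLeftUExtension U (y A) (f ≫ 𝟙 _) (E.map f ≫ E.counitAt B)
      (pasteExt U (E.unitCell f) (E.phi B)) := by
  have := (IsLeftUExtension.iso_comp_iff (ρ_ f)).2 (hcoh f)
  simpa using this

/-- The 2-cell component of the counit. -/
noncomputable def counitCell {B B' : D} (h : B ⟶ B') :
    E.map (U.map h) ≫ E.counitAt B' ⟶ E.counitAt B ≫ h :=
  (isLeftUExtension_pasteExt hcoh (U.map h)).desc
    ((ρ_ _).hom ≫ (λ_ _).inv ≫ whiskerExt U (E.phi B) h)

theorem pasteExt_counitCell {B B' : D} (h : B ⟶ B') :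
    pasteExt U (E.unitCell (U.map h)) (E.phi B') ≫ y _ ◁ U.map₂ (counitCell hcoh h) =
      (ρ_ _).hom ≫ (λ_ _).inv ≫ whiskerExt U (E.phi B) h :=
  IsLeftUExtension.fac _ _

/-- The first component of the adjunction. -/
noncomputable def psi (A : C) : E.map (y A) ≫ E.counitAt (F₀ A) ⟶ 𝟙 (F₀ A) :=
  (isLeftUExtension_pasteExt hcoh (y A)).desc
    ((ρ_ _).hom ≫ (ρ_ _).inv ≫ y A ◁ (U.mapId _).inv)

theorem pasteExt_psi (A : C) :
    pasteExt U (E.unitCell (y A)) (E.phi (F₀ A)) ≫ y A ◁ U.map₂ (psi hcoh A) =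
      (ρ_ _).hom ≫ (ρ_ _).inv ≫ y A ◁ (U.mapId _).inv :=
  IsLeftUExtension.fac _ _

-- By the unit axiom, `Ψ_A` compares two extensions of `y A`.
include hunit in
theorem isIso_psi (A : C) : IsIso (psi hcoh A) :=
  ((isLeftUExtension_pasteExt hcoh (y A)).iso
    ((IsLeftUExtension.iso_comp_iff (ρ_ _)).2 (hunit A))).isIso_hom

/-- The counit. -/
noncomputable def counit : Oplax.OplaxTrans (U.comp (pseudofunctor hunit hcomp)).toOplax
    (Pseudofunctor.id D).toOplax where
  app := E.counitAt
  naturality := counitCell hcoh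
  naturality_naturality {B B' h h'} θ := by
    change E.map₂ (U.map₂ θ) ▷ E.counitAt B' ≫ counitCell hcoh h' =
      counitCell hcoh h ≫ E.counitAt B ◁ θ
    refine (isLeftUExtension_pasteExt hcoh _).hom_ext ?_
    simp only [U.map₂_comp, whiskerLeft_comp]
    rw [← reassoc_of% pasteExt_comp_map₂_left, unitCell_map₂, reassoc_of% pasteExt_comp_left,
      pasteExt_counitCell, reassoc_of% pasteExt_counitCell, ← whiskerLeft_map₂_whiskerExt]
    simp
  naturality_id B := by
    change counitCell hcoh (𝟙 B) ≫ E.counitAt B ◁ 𝟙 (𝟙 B) =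
      (E.map₂ (U.mapId B).hom ≫ E.mapId _) ▷ E.counitAt B ≫ (λ_ _).hom ≫ (ρ_ _).inv
    refine (isLeftUExtension_pasteExt hcoh _).hom_ext ?_
    simp only [U.map₂_comp, whiskerLeft_comp, comp_whiskerRight, Category.assoc]
    rw [← reassoc_of% pasteExt_comp_map₂_left, unitCell_map₂, reassoc_of% pasteExt_comp_left,
      ← reassoc_of% pasteExt_comp_map₂_left, unitCell_mapId, pasteExt_id_left,
      reassoc_of% pasteExt_counitCell, whiskerExt_id]
    simp [reassoc_of% whiskerLeft_map₂_inv_hom, -Pseudofunctor.map₂_left_unitor,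
      -Pseudofunctor.map₂_right_unitor]
  naturality_comp {B B' B''} h k := by
    change counitCell hcoh (h ≫ k) ≫ E.counitAt B ◁ 𝟙 (h ≫ k) =
      (E.map₂ (U.mapComp h k).hom ≫ E.mapComp (U.map h) (U.map k)) ▷ E.counitAt B'' ≫
        (α_ _ _ _).hom ≫ E.map (U.map h) ◁ counitCell hcoh k ≫ (α_ _ _ _).inv ≫
          counitCell hcoh h ▷ k ≫ (α_ _ _ _).hom
    refine (isLeftUExtension_pasteExt hcoh _).hom_ext ?_
    -- Splitting the pasting for `U h ≫ U k` in two lets the defining equations of `ε_k` and then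
    -- `ε_h` apply.
    have e : pasteExt U (E.unitCell (U.map h ≫ U.map k)) (E.phi B'') ≫
        y _ ◁ U.map₂ (E.mapComp (U.map h) (U.map k) ▷ E.counitAt B'') ≫
          y _ ◁ U.map₂ (α_ _ _ _).hom = (α_ _ _ _).hom ≫
        pasteExt U (E.unitCell (U.map h)) (pasteExt U (E.unitCell (U.map k)) (E.phi B'')) := by
      rw [← reassoc_of% pasteExt_comp_map₂_left, unitCell_mapComp, pasteExt_pasteExt]
      simp
    simp only [U.map₂_comp, whiskerLeft_comp, comp_whiskerRight, Category.assoc]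
    rw [← reassoc_of% pasteExt_comp_map₂_left, unitCell_map₂, reassoc_of% pasteExt_comp_left,
      reassoc_of% e, ← reassoc_of% pasteExt_comp_map₂_right, pasteExt_counitCell,
      reassoc_of% pasteExt_comp_right, reassoc_of% pasteExt_comp_right,
      reassoc_of% pasteExt_whiskerExt,
      reassoc_of% whiskerLeft_map₂_hom_inv, ← reassoc_of% whiskerExt_comp_map₂, pasteExt_counitCell,
      reassoc_of% pasteExt_counitCell, reassoc_of% whiskerExt_comp_left,
      reassoc_of% whiskerExt_comp_left,
      reassoc_of% whiskerExt_whiskerExt]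
    simp [whiskerLeft_map₂_inv_hom, -Pseudofunctor.map₂_associator]

/-- The data of the adjunction. -/
noncomputable def adjunctionData :
    ColaxAdjunctionData (pseudofunctor hunit hcomp) U where
  unit := unit hunit hcomp
  counit := counit hunit hcomp hcoh
  Psi := psi hcoh
  Phi := E.phi

theorem isLeftUExtension_cell {A : C} {B : D} (f : A ⟶ U.obj B) :
    IsLeftUExtension U (y A) f (E.map f ≫ E.counitAt B)
      ((adjunctionData hunit hcomp hcoh).cell f) := hcoh f

theorem adjunctionData_phi : (adjunctionData hunit hcomp hcoh).PhiIsModification :=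
  (ColaxAdjunctionData.phiIsModification_iff _).2 fun h ↦ pasteExt_counitCell hcoh h

theorem adjunctionData_swallowtailUnit : (adjunctionData hunit hcomp hcoh).SwallowtailUnit := by
  refine (ColaxAdjunctionData.swallowtailUnit_iff _).2 fun A ↦ ?_
  change ((ρ_ (y A)).inv ≫ pasteExt U (E.unitCell (y A)) (E.phi (F₀ A))) ≫
    y A ◁ U.map₂ (psi hcoh A) = (ρ_ (y A)).inv ≫ y A ◁ (U.mapId _).inv
  rw [Category.assoc, pasteExt_psi, Iso.inv_hom_id_assoc]

/-- Pasted with the universal cell, one side is `η_f` by `cell_comp_transpose`. By `cell_comp`, the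
other is `η_f` pasted with a triangle that the swallowtail on `η` makes trivial. -/
theorem adjunctionData_psi : (adjunctionData hunit hcomp hcoh).PsiIsModification := by
  set S := adjunctionData hunit hcomp hcoh
  refine S.psiIsModification_iff.2 ?_
  intro A A' f
  refine (isLeftUExtension_cell hunit hcomp hcoh _).hom_ext ?_
  refine (S.cell_comp_transpose (adjunctionData_phi hunit hcomp hcoh)
    (adjunctionData_swallowtailUnit hunit hcomp hcoh) (S.unitCell f)).trans ?_
  change S.unitCell f = S.cell (f ≫ S.unitAt A') ≫ S.unitAt A ◁ U.map₂ _
  rw [← Category.assoc (Bicategory.whiskerRight _ _), U.map₂_comp (_ ≫ _), whiskerLeft_comp,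
    reassoc_of% S.cell_comp, U.map₂_comp, whiskerLeft_comp, ← reassoc_of% pasteExt_comp_map₂_right,
    S.swallowtailUnit_iff.1 (adjunctionData_swallowtailUnit hunit hcomp hcoh), pasteExt_id_right]
  simp [whiskerLeft_map₂_inv_hom, -Pseudofunctor.map₂_right_unitor]

/-- The same test against the universal cell, with `unitCell_id` in place of `cell_comp`; both sides
become `Φ_B`. -/
theorem adjunctionData_swallowtailCounit :
    (adjunctionData hunit hcomp hcoh).SwallowtailCounit := by
  set S := adjunctionData hunit hcomp hcoh
  refine S.swallowtailCounit_iff.2 fun B ↦ ?_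
  refine (isLeftUExtension_cell hunit hcomp hcoh _).hom_ext ?_
  refine (S.cell_comp_transpose (adjunctionData_phi hunit hcomp hcoh)
    (adjunctionData_swallowtailUnit hunit hcomp hcoh) (S.Φ B)).trans ?_
  change S.Φ B = S.cell (𝟙 _) ≫ S.unitAt _ ◁ U.map₂ _
  rw [ColaxAdjunctionData.cell, U.map₂_comp, whiskerLeft_comp, Category.assoc,
    ← reassoc_of% pasteExt_comp_map₂_left, S.unitCell_id, pasteExt_id_left]
  simp [whiskerLeft_map₂_inv_hom, -Pseudofunctor.map₂_left_unitor]

/-- The colax adjunction induced by a coherent choice of left `U`-extensions. -/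
noncomputable def adjunction : ColaxAdjunction (pseudofunctor hunit hcomp) U where
  toColaxAdjunctionData := adjunctionData hunit hcomp hcoh
  psi_modification := adjunctionData_psi hunit hcomp hcoh
  phi_modification := adjunctionData_phi hunit hcomp hcoh
  swallowtail_unit := adjunctionData_swallowtailUnit hunit hcomp hcoh
  swallowtail_counit := adjunctionData_swallowtailCounit hunit hcomp hcoh

end UExtensionChoice
end
end ColaxAdj

theorem theorem3 {C : Type u₁} [Bicategory.{w₁, v₁} C] {D : Type u₂} [Bicategory.{w₂, v₂} D]
    (U : D ⥤ᵖ C) (F₀ : C → D) (y : ∀ A : C, A ⟶ U.obj (F₀ A))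
    [Bicategory.Strict C] [Bicategory.Strict D] :
    (∃ E : ColaxAdj.UExtensionChoice U y,
        E.IsCoherent ∧ ColaxAdj.UnitAxiom U y ∧ E.CompositionAxiom) ↔
      (∃ (F : C ⥤ᵖ D) (adj : ColaxAdj.ColaxAdjunction F U),
        (∀ A : C, IsIso (adj.Ψ A)) ∧
        (∀ A : C, F.obj A = F₀ A) ∧ (∀ A : C, HEq (adj.unitAt A) (y A))) := by
  constructor
  · rintro ⟨E, hcoh, hunit, hcomp⟩
    exact ⟨_, ColaxAdj.UExtensionChoice.adjunction hunit hcomp hcoh,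
      ColaxAdj.UExtensionChoice.isIso_psi hunit hcoh, fun _ ↦ rfl, fun _ ↦ HEq.rfl⟩
  · rintro ⟨F, S, hΨ, hF, hy⟩
    -- Identifying the object maps first turns the heterogeneous equalities of 1-cells into ordinary
    -- ones.
    obtain rfl : F.obj = F₀ := funext hF
    obtain rfl : (fun A ↦ S.unitAt A) = y := funext fun A ↦ eq_of_heq (hy A)
    exact ColaxAdj.exists_choice_of_colaxAdjunction S hΨ
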